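/- There is an absolute constant $p>0$ such that for every $\eta>1$ and every $\alpha$ with $0<\alpha<1-1/\eta$ there is a constant $C=C(\alpha,\eta)>0$ with the following property. For all integers $n\ge 2$ and $r\ge 0$ with $n>r$ there is a dimension $d\in\mathbb{N}$ with $d\le C\,(r\log n)^{1/\alpha}$ (in particular $d$ does not depend on $D$) such that the following holds for every $D$, all $r$-dimensional linear subspaces $\mathcal S_1,\dots,\mathcal S_n$ of $\mathbb{R}^D$ and every $q\in\mathbb{R}^D$. Write $d_{\ell^1}(x,\mathcal S)=\min_{v\in \mathcal S}\|x-v\|_1$, and let $\xi_{1'}\le\dots\le\xi_{n'}$ be the distances $d_{\ell^1}(q,\mathcal S_i)$, $i=1,\dots,n$, arranged in ascending order. Suppose that $\xi_{2'}/\xi_{1'}\ge\eta$, that is, $\xi_{2'}>0$ and $\xi_{2'}\ge\eta\,\xi_{1'}$ (so $\xi_{1'}=0<\xi_{2'}$ is allowed). If $P$ is a random $d\times D$ matrix with i.i.d. standard Cauchy entries, then with probability at least $p$ $$\operatorname*{arg\,min}_{i\in\{1,\dots,n\}} d_{\ell^1}(Pq,P\mathcal S_i)=\operatorname*{arg\,min}_{i\in\{1,\dots,n\}}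 d_{\ell^1}(q,\mathcal S_i),$$ as an equality of sets of minimizers. -/

import Mathlib

open MeasureTheory ProbabilityTheory

/-- The `ℓ¹` norm `∑ i, |x i|` on `ℝ^m`. -/
noncomputable def l1Norm {m : ℕ} (x : Fin m → ℝ) : ℝ := ∑ i, |x i|

/-- The `ℓ¹` distance of a point to a linear subspace of `ℝ^m`. -/
noncomputable def l1Dist {m : ℕ} (q : Fin m → ℝ) (S : Submodule ℝ (Fin m → ℝ)) : ℝ :=
  ⨅ v : S, l1Norm (q - (v : Fin m → ℝ))

/-- The set of all indices at which `f` attains its minimum. -/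
def argminSet {ι : Type*} (f : ι → ℝ) : Set ι := {i | ∀ j, f i ≤ f j}

/-- The values of `f` arranged in ascending order (with multiplicity). -/
noncomputable def ascending {n : ℕ} (f : Fin n → ℝ) : Fin n → ℝ := f ∘ Tuple.sort f

/-- The entries of the random matrix `P` are independent standard Cauchy variables. -/
structure IsIIDCauchy {Ω : Type*} [MeasurableSpace Ω] {d D : ℕ}
    (P : Ω → Matrix (Fin d) (Fin D) ℝ) (μ : Measure Ω) : Prop where
  indep : iIndepFun (fun (e : Fin d × Fin D) (ω : Ω) => P ω e.1 e.2) μ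
  law : ∀ i j, HasLaw (fun ω => P ω i j) (cauchyMeasure 0 1) μ

/-! Cauchy variables are 1-stable: for a fixed `x` the entries of `P x` are independent and
distributed as `‖x‖₁` times a standard Cauchy variable (`IsIIDCauchy.integral_exp_mulVec`). So `‖P
x‖₁ / ‖x‖₁` is a sum of `d` Cauchy moduli, typically of size `(2/π) d log d`, with very different
tails on the two sides. The upper bound holds only with constant probability
(`measureReal_le_sum_abs_le`, truncation at `8d`). The lower bound `(1 - α) (2/π) d log d`, up to
lower order terms, fails with probability at most `exp (-d ^ α)` (`measureReal_sum_abs_le_le`,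
truncation at `d ^ (1 - α)`).

This asymmetry is affordable. No expansion is needed for just one vector `q - v`, with `v` almost
nearest to `q` in the nearest subspace; no contraction is needed on all of `S j + span q`, for each
`j`. The two bounds have ratio close to `1 - α > 1/η`, so they cannot undo a gap of factor `η`.

The uniform lower bound comes from a union bound over grids built on Auerbach bases
(`exists_auerbach_family`, `le_l1Norm_mulVec_of_grid`). Each grid has `(2N + 1) ^ (r + 1)` points
with `N` polynomial in `n` and `d`, so `d ^ α` must dominate `r log (n d)`; this gives `d` of order
`(r log n) ^ (1/α)` (`exists_dimension_constant`). -/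

/-! ### Characteristic function of the Cauchy law -/

open scoped FourierTransform in
-- Split at `0`, the integral is the sum of two complex exponential integrals, `1/a` and `-1/b`,
-- which combine to the Cauchy density. Fourier inversion then yields the characteristic function
-- without contour integration.
theorem fourier_exp_neg_two_pi_abs (ξ : ℝ) :
    𝓕 (fun v : ℝ => (Real.exp (-(2 * Real.pi * |v|)) : ℂ)) ξ = (cauchyPDFReal 0 1 ξ : ℂ) := by
  have hpi := Real.pi_pos
  set a : ℂ := 2 * Real.pi * (1 - ξ * Complex.I) with ha
  set b : ℂ := -(2 * Real.pi * (1 + ξ * Complex.I)) with hb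
  have hare : 0 < a.re := by simp [ha, hpi]
  have hbre : b.re < 0 := by simp [hb, hpi]
  have e1 : Set.EqOn (fun v : ℝ => Real.fourierChar (-(v * ξ)) •
      (Real.exp (-(2 * Real.pi * |v|)) : ℂ)) (fun v => Complex.exp (a * v)) (Set.Iic 0) := by
    intro v hv
    simp only [Real.fourierChar_apply', Circle.smul_def, Circle.coe_exp, smul_eq_mul,
      abs_of_nonpos (Set.mem_Iic.1 hv), Complex.ofReal_exp, ← Complex.exp_add, ha]
    congr 1; push_cast; ring
  have e2 : Set.EqOn (fun v : ℝ => Real.fourierChar (-(v * ξ)) •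
      (Real.exp (-(2 * Real.pi * |v|)) : ℂ)) (fun v => Complex.exp (b * v)) (Set.Ioi 0) := by
    intro v hv
    simp only [Real.fourierChar_apply', Circle.smul_def, Circle.coe_exp, smul_eq_mul,
      abs_of_pos (Set.mem_Ioi.1 hv), Complex.ofReal_exp, ← Complex.exp_add, hb]
    congr 1; push_cast; ring
  have i1 := (integrableOn_exp_mul_complex_Iic hare 0).congr_fun e1.symm measurableSet_Iic
  have i2 := (integrableOn_exp_mul_complex_Ioi hbre 0).congr_fun e2.symm measurableSet_Ioi
  rw [Real.fourier_real_eq, ← intervalIntegral.integral_Iic_add_Ioi i1 i2,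
    setIntegral_congr_fun measurableSet_Iic e1, setIntegral_congr_fun measurableSet_Ioi e2,
    integral_exp_mul_complex_Iic hare, integral_exp_mul_complex_Ioi hbre]
  have h1 : (1 : ℂ) - ξ * Complex.I ≠ 0 := by
    intro h; have := congrArg Complex.re h; simp at this
  have h2 : (1 : ℂ) + ξ * Complex.I ≠ 0 := by
    intro h; have := congrArg Complex.re h; simp at this
  have h3 : (1 : ℂ) + ξ ^ 2 ≠ 0 := by
    have : (1 : ℂ) + ξ ^ 2 = (1 - ξ * Complex.I) * (1 + ξ * Complex.I) := by
      ring_nf; simp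
    rw [this]; exact mul_ne_zero h1 h2
  have hpi' : (Real.pi : ℂ) ≠ 0 := by exact_mod_cast hpi.ne'
  simp only [cauchyPDFReal, ha, hb]
  have h4 : (ξ : ℂ) ^ 2 + 1 ≠ 0 := by rwa [add_comm]
  push_cast
  simp only [mul_zero, Complex.exp_zero, sub_zero, one_pow, mul_one]
  field_simp
  ring_nf
  simp only [Complex.I_sq]
  ring

open scoped FourierTransform in
/-- The characteristic function of the standard Cauchy distribution. -/
theorem charFun_cauchyMeasure (t : ℝ) :
    charFun (cauchyMeasure 0 1) t = (Real.exp (-|t|) : ℂ) := by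
  have hpi := Real.pi_pos
  set f : ℝ → ℂ := fun v : ℝ => (Real.exp (-(2 * Real.pi * |v|)) : ℂ) with hf
  have hF : 𝓕 f = fun ξ => (cauchyPDFReal 0 1 ξ : ℂ) := funext fourier_exp_neg_two_pi_abs
  have hcont : Continuous f := by fun_prop
  have hint : Integrable f := by
    have : Integrable (fun v : ℝ => Real.exp (-(2 * Real.pi * |v|))) := by
      -- A non-integrable function has integral `0` by convention, so a nonzero value proves
      -- integrability.
      refine Integrable.of_integral_ne_zero ?_
      rw [integral_comp_abs (f := fun v : ℝ => Real.exp (-(2 * Real.pi * v)))]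
      simp only [← neg_mul]
      rw [integral_exp_mul_Ioi (by simpa using hpi)]
      simp [hpi.ne']
    exact this.ofReal
  have hint' : Integrable (𝓕 f) := by
    rw [hF]; exact (integrable_cauchyPDFReal 0).ofReal
  -- The point `t / (2π)` converts the kernel `exp (2πi x v)` into `exp (i t x)`.
  have key := congrFun (hcont.fourierInv_fourier_eq hint hint') ((2 * Real.pi)⁻¹ * t)
  rw [hF, Real.fourierInv_eq'] at key
  rw [charFun_apply_real, cauchyMeasure_of_scale_ne_zero _ one_ne_zero,
    integral_withDensity_eq_integral_toReal_smul (by fun_prop) (by simp [cauchyPDF])]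
  have hv : f ((2 * Real.pi)⁻¹ * t) = (Real.exp (-|t|) : ℂ) := by
    simp only [hf]
    rw [abs_mul, abs_of_pos (by positivity : 0 < (2 * Real.pi)⁻¹)]
    congr 3; field_simp
  rw [← hv, ← key]
  refine integral_congr_ae (ae_of_all _ fun x => ?_)
  have hp : 0 ≤ cauchyPDFReal 0 1 x := (cauchyPDF_pos 0 one_ne_zero x).le
  simp only [cauchyPDF, ENNReal.toReal_ofReal hp, Complex.real_smul, smul_eq_mul]
  rw [mul_comm]
  congr 2
  simp
  have hpi' : (Real.pi : ℂ) ≠ 0 := by exact_mod_cast hpi.ne'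
  field_simp

theorem l1Norm_nonneg {m : ℕ} (x : Fin m → ℝ) : 0 ≤ l1Norm x :=
  Finset.sum_nonneg fun _ _ => abs_nonneg _

/-! ### 1-stability: the law of `P x` -/

section Rows

variable {Ω : Type*} [MeasurableSpace Ω] {μ : Measure Ω} {d D : ℕ}
  {P : Ω → Matrix (Fin d) (Fin D) ℝ}

/-- The joint characteristic function of the entries of a Cauchy matrix. -/
theorem IsIIDCauchy.integral_exp_sum (hP : IsIIDCauchy P μ) (c : Fin d × Fin D → ℝ) :
    ∫ ω, Complex.exp ((∑ e, c e * P ω e.1 e.2 : ℝ) * Complex.I) ∂μ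
      = (Real.exp (-∑ e, |c e|) : ℂ) := by
  have hmeas : ∀ e : Fin d × Fin D, AEMeasurable (fun ω => P ω e.1 e.2) μ :=
    fun e => (hP.law e.1 e.2).aemeasurable
  have hm : ∀ e : Fin d × Fin D, AEMeasurable (fun ω => c e * P ω e.1 e.2) μ :=
    fun e => (hmeas e).const_mul _
  have hi : iIndepFun (fun (e : Fin d × Fin D) (ω : Ω) => c e * P ω e.1 e.2) μ :=
    hP.indep.comp (fun e x => c e * x) (fun e => measurable_const_mul _)
  have key := congrFun (hi.charFun_map_fun_sum_eq_prod hm) 1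
  rw [charFun_apply_real, integral_map (Finset.aemeasurable_fun_sum _ fun e _ => hm e)
    (by fun_prop)] at key
  simp only [Complex.ofReal_one, one_mul, Finset.prod_apply] at key
  rw [key, Complex.ofReal_exp, Complex.ofReal_neg, Complex.ofReal_sum, ← Finset.sum_neg_distrib,
    Complex.exp_sum]
  refine Finset.prod_congr rfl fun e _ => ?_
  rw [charFun_map_mul_comp (hmeas e), (hP.law e.1 e.2).map_eq, charFun_cauchyMeasure]
  simp

theorem IsIIDCauchy.aemeasurable_mulVec (hP : IsIIDCauchy P μ) (x : Fin D → ℝ) (i : Fin d) :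
    AEMeasurable (fun ω => (P ω).mulVec x i) μ := by
  simp only [Matrix.mulVec, dotProduct]
  exact Finset.aemeasurable_fun_sum _ fun j _ => (hP.law i j).aemeasurable.mul_const _

/-- The entry `(i, j)` of `P` has coefficient `t i * x j`, and these moduli sum to `(∑ |t i|) ‖x‖₁`.
The product form gives both the marginals and the independence of the coordinates of `P x`. -/
theorem IsIIDCauchy.integral_exp_mulVec (hP : IsIIDCauchy P μ) (x : Fin D → ℝ) (t : Fin d → ℝ) :
    ∫ ω, Complex.exp ((∑ i, t i * (P ω).mulVec x i : ℝ) * Complex.I) ∂μ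
      = ∏ i, (Real.exp (-(|t i| * l1Norm x)) : ℂ) := by
  have h := hP.integral_exp_sum (fun e => t e.1 * x e.2)
  simp only [Fintype.sum_prod_type, abs_mul, ← Finset.mul_sum] at h
  rw [← Complex.ofReal_prod, ← Real.exp_sum, Finset.sum_neg_distrib]
  rw [show (∑ i, |t i| * l1Norm x) = ∑ i, |t i| * ∑ j, |x j| from rfl, ← h]
  refine integral_congr_ae (ae_of_all _ fun ω => ?_)
  simp only [Matrix.mulVec, dotProduct, Finset.mul_sum]
  congr 5
  ext i
  congr 1
  ext j
  ring

theorem IsIIDCauchy.charFun_mulVec (hP : IsIIDCauchy P μ) (x : Fin D → ℝ) (i : Fin d) (t : ℝ) :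
    charFun (μ.map fun ω => (P ω).mulVec x i) t = (Real.exp (-(|t| * l1Norm x)) : ℂ) := by
  rw [charFun_apply_real, integral_map (hP.aemeasurable_mulVec x i) (by fun_prop)]
  have : IsProbabilityMeasure μ := hP.indep.isProbabilityMeasure
  have h := hP.integral_exp_mulVec x (Pi.single i t)
  rw [Finset.prod_eq_single i (fun j _ hj => by simp [hj]) (by simp)] at h
  simp only [Pi.single_eq_same] at h
  rw [← h]
  refine integral_congr_ae (ae_of_all _ fun ω => ?_)
  simp only
  rw [Finset.sum_eq_single i (fun j _ hj => by simp [hj]) (by simp)]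
  simp

/-- The image of an `ℓ¹`-unit vector under a Cauchy matrix has standard Cauchy entries. -/
theorem IsIIDCauchy.hasLaw_mulVec (hP : IsIIDCauchy P μ) {x : Fin D → ℝ} (hx : l1Norm x = 1)
    (i : Fin d) : HasLaw (fun ω => (P ω).mulVec x i) (cauchyMeasure 0 1) μ where
  aemeasurable := hP.aemeasurable_mulVec x i
  map_eq := by
    have : IsProbabilityMeasure μ := hP.indep.isProbabilityMeasure
    refine Measure.ext_of_charFun (funext fun t => ?_)
    rw [hP.charFun_mulVec, charFun_cauchyMeasure, hx, mul_one]

theorem IsIIDCauchy.iIndepFun_mulVec (hP : IsIIDCauchy P μ) (x : Fin D → ℝ) :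
    iIndepFun (fun i ω => (P ω).mulVec x i) μ := by
  have : IsProbabilityMeasure μ := hP.indep.isProbabilityMeasure
  rw [iIndepFun_iff_charFun_pi (hP.aemeasurable_mulVec x)]
  intro t
  have hm : AEMeasurable (fun ω => WithLp.toLp 2 fun i => (P ω).mulVec x i) μ :=
    (MeasurableEquiv.toLp 2 (Fin d → ℝ)).measurable.comp_aemeasurable
      (aemeasurable_pi_lambda _ (hP.aemeasurable_mulVec x))
  rw [charFun_apply, integral_map hm (by fun_prop)]
  simp_rw [hP.charFun_mulVec]
  rw [← hP.integral_exp_mulVec x t]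
  refine integral_congr_ae (ae_of_all _ fun ω => ?_)
  simp [PiLp.inner_apply]

end Rows

/-! ### Moments and tails of the truncated Cauchy modulus -/

/-- The truncation of `|x|` to zero outside `[-T, T]`. -/
noncomputable def truncAbs (T x : ℝ) : ℝ := (Set.Iic T).indicator id |x|

theorem truncAbs_of_le {T x : ℝ} (h : |x| ≤ T) : truncAbs T x = |x| :=
  Set.indicator_of_mem (Set.mem_Iic.2 h) _

theorem truncAbs_nonneg (T x : ℝ) : 0 ≤ truncAbs T x := by
  unfold truncAbs Set.indicator; split_ifs <;> simp

theorem truncAbs_le_abs (T x : ℝ) : truncAbs T x ≤ |x| := by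
  unfold truncAbs Set.indicator; split_ifs <;> simp

theorem truncAbs_le {T : ℝ} (hT : 0 ≤ T) (x : ℝ) : truncAbs T x ≤ T := by
  unfold truncAbs Set.indicator; split_ifs with h
  · exact h
  · exact hT

theorem measurable_truncAbs (T : ℝ) : Measurable (truncAbs T) :=
  (measurable_id.indicator measurableSet_Iic).comp measurable_id.abs

/-- The expectation of `f |X|` for a standard Cauchy `X` and `f` truncated at `T`. -/
theorem integral_cauchyMeasure_indicator_abs {T : ℝ} (hT : 0 ≤ T) (f : ℝ → ℝ) :
    ∫ x, (Set.Iic T).indicator f |x| ∂(cauchyMeasure 0 1)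
      = 2 / Real.pi * ∫ x in (0 : ℝ)..T, f x * (1 + x ^ 2)⁻¹ := by
  have hpi := Real.pi_pos
  rw [cauchyMeasure_of_scale_ne_zero _ one_ne_zero,
    integral_withDensity_eq_integral_toReal_smul (by fun_prop) (by simp [cauchyPDF])]
  have h : ∀ x : ℝ, (cauchyPDF 0 1 x).toReal • (Set.Iic T).indicator f |x|
      = (fun y => Real.pi⁻¹ * (Set.Iic T).indicator (fun z => f z * (1 + z ^ 2)⁻¹) y) |x| := by
    intro x
    rw [cauchyPDF, ENNReal.toReal_ofReal (cauchyPDF_pos 0 one_ne_zero x).le, cauchyPDFReal]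
    simp only [Set.indicator, smul_eq_mul, sub_zero, NNReal.coe_one, sq_abs]
    split_ifs
    · rw [add_comm (x ^ 2)]; ring
    · simp
  simp_rw [h]
  rw [integral_comp_abs (f := fun y => Real.pi⁻¹ *
    (Set.Iic T).indicator (fun z => f z * (1 + z ^ 2)⁻¹) y), integral_const_mul,
    setIntegral_indicator measurableSet_Iic, Set.Ioi_inter_Iic, intervalIntegral.integral_of_le hT]
  ring

/-- The mean grows like `(2/π) log T`, so truncating at `d ^ (1 - α)` instead of at order `d` costs
only the factor `1 - α` to leading order. -/
theorem integral_truncAbs {T : ℝ} (hT : 0 ≤ T) :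
    ∫ x, truncAbs T x ∂(cauchyMeasure 0 1) = Real.log (1 + T ^ 2) / Real.pi := by
  have h := integral_cauchyMeasure_indicator_abs hT id
  have h2 : ∫ x in (0 : ℝ)..T, id x * (1 + x ^ 2)⁻¹ = Real.log (1 + T ^ 2) / 2 := by
    have hd : ∀ x ∈ Set.uIcc 0 T, HasDerivAt (fun x : ℝ => Real.log (1 + x ^ 2) / 2)
        (id x * (1 + x ^ 2)⁻¹) x := by
      intro x _
      have hne : (1 : ℝ) + x ^ 2 ≠ 0 := by positivity
      have := ((((hasDerivAt_id x).pow 2).const_add 1).log hne).div_const 2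
      convert! this using 1
      simp; field_simp
    rw [intervalIntegral.integral_eq_sub_of_hasDerivAt hd]
    · simp
    · refine Continuous.intervalIntegrable ?_ _ _
      exact continuous_id.mul (Continuous.inv₀ (by fun_prop) fun x => by positivity)
  rw [h2] at h
  unfold truncAbs
  rw [h]; ring

theorem integral_truncAbs_sq_le {T : ℝ} (hT : 0 ≤ T) :
    ∫ x, truncAbs T x ^ 2 ∂(cauchyMeasure 0 1) ≤ 2 / Real.pi * T := by
  have hpi := Real.pi_pos
  have h := integral_cauchyMeasure_indicator_abs hT (fun x => x ^ 2)
  have e : ∀ x, truncAbs T x ^ 2 = (Set.Iic T).indicator (fun x => x ^ 2) |x| := by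
    intro x; unfold truncAbs Set.indicator; split_ifs <;> simp
  simp_rw [e]
  rw [h]
  refine mul_le_mul_of_nonneg_left ?_ (by positivity)
  have hc : Continuous fun x : ℝ => x ^ 2 * (1 + x ^ 2)⁻¹ :=
    (continuous_pow 2).mul (Continuous.inv₀ (by fun_prop) fun x => by positivity)
  calc ∫ x in (0 : ℝ)..T, x ^ 2 * (1 + x ^ 2)⁻¹ ≤ ∫ _ in (0 : ℝ)..T, (1 : ℝ) := by
        refine intervalIntegral.integral_mono_on hT (hc.intervalIntegrable _ _) (by simp) ?_
        intro x _
        rw [← div_eq_mul_inv, div_le_one (by positivity)]; linarith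
    _ = T := by simp

/-- The tail is exactly `(2/π) arctan (1/T)`, and `arctan y ≤ y`. -/
theorem cauchyMeasure_real_abs_gt_le {T : ℝ} (hT : 0 < T) :
    (cauchyMeasure 0 1).real {x | T < |x|} ≤ 1 / T := by
  have hpi := Real.pi_gt_three
  have h := integral_cauchyMeasure_indicator_abs hT.le (fun _ => 1)
  have hs : MeasurableSet {x : ℝ | |x| ≤ T} := measurableSet_le measurable_id.abs measurable_const
  have e : ∀ x : ℝ, (Set.Iic T).indicator (fun _ => (1 : ℝ)) |x|
      = {x : ℝ | |x| ≤ T}.indicator (fun _ => 1) x := fun x => rfl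
  simp_rw [e] at h
  rw [integral_indicator_const _ hs] at h
  simp only [one_mul, integral_inv_one_add_sq, smul_eq_mul, mul_one, Real.arctan_zero,
    sub_zero] at h
  have hc : {x : ℝ | T < |x|} = {x : ℝ | |x| ≤ T}ᶜ := by ext; simp
  rw [hc, probReal_compl_eq_one_sub hs, h]
  have h1 := Real.arctan_inv_of_pos hT
  have h2 : Real.arctan T⁻¹ ≤ T⁻¹ := by
    have := Real.arctan_lt_pi_div_two T⁻¹
    have h0 : 0 < Real.arctan T⁻¹ := Real.arctan_pos.2 (by positivity)
    have := Real.lt_tan h0 this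
    rw [Real.tan_arctan] at this
    exact this.le
  have h3 : Real.arctan T = Real.pi / 2 - Real.arctan T⁻¹ := by rw [h1]; ring
  rw [h3]
  have h4 : 1 - 2 / Real.pi * (Real.pi / 2 - Real.arctan T⁻¹)
      = 2 / Real.pi * Real.arctan T⁻¹ := by field_simp; ring
  rw [h4, one_div]
  calc 2 / Real.pi * Real.arctan T⁻¹ ≤ 1 * T⁻¹ := by
        refine mul_le_mul ?_ h2 (Real.arctan_pos.2 (by positivity)).le zero_le_one
        rw [div_le_one (by positivity)]; linarith
    _ = T⁻¹ := one_mul _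

theorem integrable_truncAbs {T : ℝ} (hT : 0 ≤ T) : Integrable (truncAbs T) (cauchyMeasure 0 1) :=
  Integrable.of_bound (measurable_truncAbs T).aestronglyMeasurable T
    (ae_of_all _ fun x => by
      rw [Real.norm_eq_abs, abs_of_nonneg (truncAbs_nonneg T x)]; exact truncAbs_le hT x)

theorem integrable_truncAbs_sq {T : ℝ} (hT : 0 ≤ T) :
    Integrable (fun x => truncAbs T x ^ 2) (cauchyMeasure 0 1) :=
  Integrable.of_bound ((measurable_truncAbs T).pow_const 2).aestronglyMeasurable (T ^ 2)
    (ae_of_all _ fun x => by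
      rw [Real.norm_eq_abs, abs_of_nonneg (by positivity)]
      exact pow_le_pow_left₀ (truncAbs_nonneg T x) (truncAbs_le hT x) 2)

theorem integrable_exp_mul_truncAbs {T : ℝ} (hT : 0 ≤ T) (s : ℝ) :
    Integrable (fun x => Real.exp (s * truncAbs T x)) (cauchyMeasure 0 1) :=
  Integrable.of_bound ((measurable_truncAbs T).const_mul s).exp.aestronglyMeasurable
    (Real.exp (|s| * T))
    (ae_of_all _ fun x => by
      rw [Real.norm_eq_abs, Real.abs_exp, Real.exp_le_exp]
      have := mul_le_mul_of_nonneg_left (truncAbs_le hT x) (abs_nonneg s)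
      have := mul_le_mul_of_nonneg_right (le_abs_self s) (truncAbs_nonneg T x)
      linarith)

/-- The moment generating function of the truncated Cauchy modulus at a scale `|s| ≤ 1 / T`. -/
theorem mgf_truncAbs_le {T : ℝ} (hT : 0 < T) {s : ℝ} (hs : |s| * T ≤ 1) :
    mgf (truncAbs T) (cauchyMeasure 0 1) s
      ≤ Real.exp (s * (Real.log (1 + T ^ 2) / Real.pi) + s ^ 2 * T) := by
  have hpi := Real.pi_gt_three
  -- `exp y ≤ 1 + y + y²` for `|y| ≤ 1`, which is where `|s| * T ≤ 1` enters.
  have hb : ∀ x, Real.exp (s * truncAbs T x)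
      ≤ 1 + s * truncAbs T x + s ^ 2 * truncAbs T x ^ 2 := by
    intro x
    have h1 : |s * truncAbs T x| ≤ 1 := by
      rw [abs_mul, abs_of_nonneg (truncAbs_nonneg T x)]
      exact (mul_le_mul_of_nonneg_left (truncAbs_le hT.le x) (abs_nonneg s)).trans hs
    have := (abs_le.1 (Real.abs_exp_sub_one_sub_id_le h1)).2
    rw [mul_pow] at this; linarith
  have i1 := (integrable_truncAbs hT.le).const_mul s
  have i2 := (integrable_truncAbs_sq hT.le).const_mul (s ^ 2)
  have i0 : Integrable (fun _ : ℝ => (1 : ℝ)) (cauchyMeasure 0 1) := integrable_const 1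
  have h := integral_mono (integrable_exp_mul_truncAbs hT.le s) ((i0.add i1).add i2) hb
  rw [integral_add' (i0.add i1) i2, integral_add' i0 i1, integral_const_mul, integral_const_mul,
    integral_truncAbs hT.le] at h
  simp only [integral_const, probReal_univ, smul_eq_mul, mul_one] at h
  have h2 : s ^ 2 * ∫ x, truncAbs T x ^ 2 ∂(cauchyMeasure 0 1) ≤ s ^ 2 * T := by
    refine mul_le_mul_of_nonneg_left ((integral_truncAbs_sq_le hT.le).trans ?_) (sq_nonneg s)
    have : 2 / Real.pi ≤ 1 := by rw [div_le_one (by positivity)]; linarith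
    nlinarith
  refine h.trans (le_trans ?_ (Real.add_one_le_exp _))
  linarith

/-! ### Chernoff bounds for sums of Cauchy moduli -/

section Chernoff

variable {Ω : Type*} [MeasurableSpace Ω] {μ : Measure Ω} {d : ℕ} {Z : Fin d → Ω → ℝ}

theorem integrable_exp_mul_sum_truncAbs (hi : iIndepFun Z μ)
    (hl : ∀ i, HasLaw (Z i) (cauchyMeasure 0 1) μ) {T : ℝ} (hT : 0 ≤ T) (s : ℝ) :
    Integrable (fun ω => Real.exp (s * (∑ i, fun ω => truncAbs T (Z i ω)) ω)) μ := by
  have : IsProbabilityMeasure μ := hi.isProbabilityMeasure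
  have hm : AEMeasurable (∑ i, fun ω => truncAbs T (Z i ω)) μ :=
    Finset.aemeasurable_sum _ fun i _ => (measurable_truncAbs T).comp_aemeasurable (hl i).aemeasurable
  refine Integrable.of_bound (hm.const_mul s).exp.aestronglyMeasurable
    (Real.exp (|s| * (d * T))) (ae_of_all _ fun x => ?_)
  rw [Real.norm_eq_abs, Real.abs_exp, Real.exp_le_exp]
  have h1 : (∑ i, fun ω => truncAbs T (Z i ω)) x ≤ d * T := by
    rw [Finset.sum_apply]
    refine (Finset.sum_le_card_nsmul _ _ T fun i _ => truncAbs_le hT _).trans ?_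
    simp
  have h0 : 0 ≤ (∑ i, fun ω => truncAbs T (Z i ω)) x := by
    rw [Finset.sum_apply]
    exact Finset.sum_nonneg fun i _ => truncAbs_nonneg _ _
  exact (mul_le_mul_of_nonneg_right (le_abs_self s) h0).trans
    (mul_le_mul_of_nonneg_left h1 (abs_nonneg s))

theorem mgf_sum_truncAbs_le (hi : iIndepFun Z μ)
    (hl : ∀ i, HasLaw (Z i) (cauchyMeasure 0 1) μ) {T : ℝ} (hT : 0 < T) {s : ℝ}
    (hs : |s| * T ≤ 1) :
    mgf (∑ i, fun ω => truncAbs T (Z i ω)) μ s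
      ≤ Real.exp (d * (s * (Real.log (1 + T ^ 2) / Real.pi) + s ^ 2 * T)) := by
  have hi' : iIndepFun (fun i ω => truncAbs T (Z i ω)) μ :=
    hi.comp (fun _ => truncAbs T) (fun _ => measurable_truncAbs T)
  rw [hi'.mgf_sum₀ fun i => (measurable_truncAbs T).comp_aemeasurable (hl i).aemeasurable,
    Real.exp_nat_mul]
  rw [← Fin.prod_const]
  refine Finset.prod_le_prod (fun _ _ => mgf_nonneg) fun i _ => ?_
  refine le_of_eq_of_le ?_ (mgf_truncAbs_le hT hs)
  rw [← (hl i).map_eq, mgf_map (hl i).aemeasurable]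
  · rfl
  · exact ((measurable_truncAbs T).const_mul s).exp.aestronglyMeasurable

/-- Lower tail of a sum of moduli of independent standard Cauchy variables. -/
theorem measureReal_sum_abs_le_le (hi : iIndepFun Z μ)
    (hl : ∀ i, HasLaw (Z i) (cauchyMeasure 0 1) μ) {T : ℝ} (hT : 0 < T) :
    μ.real {ω | ∑ i, |Z i ω| ≤ d * (Real.log (1 + T ^ 2) / Real.pi - 2)}
      ≤ Real.exp (-(d / T)) := by
  have : IsProbabilityMeasure μ := hi.isProbabilityMeasure
  have hs : |(-T⁻¹)| * T ≤ 1 := by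
    rw [abs_neg, abs_of_pos (by positivity), inv_mul_cancel₀ hT.ne']
  have h2 := mgf_sum_truncAbs_le hi hl hT hs
  set A := Real.log (1 + T ^ 2) / Real.pi
  -- With `s = -1/T` the second-order term costs `d/T` in the exponent. Of the margin `2`, one unit
  -- pays for it and the other leaves `-d/T`.
  have h1 := measure_le_le_exp_mul_mgf (d * (A - 2)) (neg_nonpos.2 (inv_pos.2 hT).le)
    (integrable_exp_mul_sum_truncAbs hi hl hT.le (-T⁻¹))
  calc _ ≤ μ.real {ω | (∑ i, fun ω => truncAbs T (Z i ω)) ω ≤ d * (A - 2)} := by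
        refine measureReal_mono fun ω hω => ?_
        simp only [Set.mem_ofPred_eq, Finset.sum_apply] at hω ⊢
        exact (Finset.sum_le_sum fun i _ => truncAbs_le_abs T _).trans hω
    _ ≤ _ := h1
    _ ≤ _ := mul_le_mul_of_nonneg_left h2 (Real.exp_pos _).le
    _ = _ := by
        rw [← Real.exp_add]
        congr 1
        field_simp
        ring

/-- Upper tail of a sum of moduli of independent standard Cauchy variables. -/
theorem measureReal_le_sum_abs_le (hi : iIndepFun Z μ)
    (hl : ∀ i, HasLaw (Z i) (cauchyMeasure 0 1) μ) {T : ℝ} (hT : 0 < T) :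
    μ.real {ω | d * (Real.log (1 + T ^ 2) / Real.pi + 1) + 2 * T ≤ ∑ i, |Z i ω|}
      ≤ d / T + Real.exp (-2) := by
  have : IsProbabilityMeasure μ := hi.isProbabilityMeasure
  have hs : |T⁻¹| * T ≤ 1 := by
    rw [abs_of_pos (by positivity), inv_mul_cancel₀ hT.ne']
  have h2 := mgf_sum_truncAbs_le hi hl hT hs
  set A := Real.log (1 + T ^ 2) / Real.pi
  -- With `s = 1/T` the margin `d` cancels the second-order term and `2 * T` leaves `exp (-2)`.
  have h1 := measure_ge_le_exp_mul_mgf (d * (A + 1) + 2 * T) (inv_pos.2 hT).le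
    (integrable_exp_mul_sum_truncAbs hi hl hT.le T⁻¹)
  -- Outside this event truncation changes no summand.
  have h3 : μ.real (⋃ i, {ω | T < |Z i ω|}) ≤ d / T := by
    refine (measureReal_iUnion_fintype_le _).trans ?_
    refine (Finset.sum_le_card_nsmul _ _ (1 / T) fun i _ => ?_).trans_eq ?_
    · have hms : MeasurableSet {x : ℝ | T < |x|} :=
        measurableSet_lt measurable_const measurable_id.abs
      rw [(hl i).measureReal_eq hms]
      exact cauchyMeasure_real_abs_gt_le hT
    · simp [div_eq_mul_inv]
  calc _ ≤ μ.real ((⋃ i, {ω | T < |Z i ω|}) ∪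
        {ω | d * (A + 1) + 2 * T ≤ (∑ i, fun ω => truncAbs T (Z i ω)) ω}) := by
        refine measureReal_mono fun ω hω => ?_
        by_cases hc : ∃ i, T < |Z i ω|
        · left; simpa using hc
        · right
          push Not at hc
          simp only [Set.mem_ofPred_eq, Finset.sum_apply] at hω ⊢
          rwa [Finset.sum_congr rfl fun i _ => truncAbs_of_le (hc i)]
    _ ≤ _ := measureReal_union_le _ _
    _ ≤ _ := add_le_add h3 (h1.trans (mul_le_mul_of_nonneg_left h2 (Real.exp_pos _).le))
    _ = _ := by
        rw [← Real.exp_add]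
        congr 2
        field_simp
        ring

end Chernoff

/-! ### The `ℓ¹` norm, Auerbach bases and grids -/

theorem l1Norm_add_le {m : ℕ} (x y : Fin m → ℝ) : l1Norm (x + y) ≤ l1Norm x + l1Norm y := by
  unfold l1Norm
  rw [← Finset.sum_add_distrib]
  exact Finset.sum_le_sum fun i _ => abs_add_le _ _

theorem l1Norm_smul {m : ℕ} (a : ℝ) (x : Fin m → ℝ) : l1Norm (a • x) = |a| * l1Norm x := by
  simp [l1Norm, abs_mul, Finset.mul_sum]

theorem l1Norm_zero {m : ℕ} : l1Norm (0 : Fin m → ℝ) = 0 := by simp [l1Norm]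

theorem l1Norm_sum_le {m : ℕ} {ι : Type*} (s : Finset ι) (f : ι → Fin m → ℝ) :
    l1Norm (∑ j ∈ s, f j) ≤ ∑ j ∈ s, l1Norm (f j) :=
  Finset.le_sum_of_subadditive l1Norm l1Norm_zero.le l1Norm_add_le s f

theorem continuous_l1Norm {m : ℕ} : Continuous (l1Norm : (Fin m → ℝ) → ℝ) := by
  unfold l1Norm; fun_prop

theorem norm_le_l1Norm {m : ℕ} (x : Fin m → ℝ) : ‖x‖ ≤ l1Norm x := by
  rw [pi_norm_le_iff_of_nonneg (l1Norm_nonneg x)]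
  intro i
  exact Finset.single_le_sum (f := fun i => |x i|) (fun i _ => abs_nonneg _) (Finset.mem_univ i)

theorem l1Norm_eq_zero {m : ℕ} {x : Fin m → ℝ} (h : l1Norm x = 0) : x = 0 :=
  norm_le_zero_iff.1 ((norm_le_l1Norm x).trans_eq h)

/-- Existence of an Auerbach basis, for the pullback of the `ℓ¹` norm along an injection. -/
theorem exists_auerbach_matrix {D k : ℕ} (φ : (Fin k → ℝ) →ₗ[ℝ] (Fin D → ℝ))
    (hφ : Function.Injective φ) :
    ∃ A : Fin k → Fin k → ℝ, (∀ j, l1Norm (φ (A j)) ≤ 1) ∧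
      ∀ b, l1Norm (φ b) ≤ 1 → ∃ c : Fin k → ℝ, (∀ j, |c j| ≤ 1) ∧ b = ∑ j, c j • A j := by
  have hφc : Continuous φ := φ.continuous_of_finiteDimensional
  set K : Set (Fin k → Fin k → ℝ) := {A | ∀ j, l1Norm (φ (A j)) ≤ 1} with hK
  have hclosed : IsClosed K := by
    rw [hK]
    simp only [Set.ofPred_forall]
    refine isClosed_iInter fun j => isClosed_le ?_ continuous_const
    exact continuous_l1Norm.comp (hφc.comp (continuous_apply j))
  obtain ⟨L, -, hL⟩ := φ.exists_antilipschitzWith (LinearMap.ker_eq_bot.2 hφ)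
  have hbdd : Bornology.IsBounded K := by
    refine (Metric.isBounded_closedBall (x := 0) (r := L)).subset fun A hA => ?_
    rw [mem_closedBall_zero_iff, pi_norm_le_iff_of_nonneg L.coe_nonneg]
    intro j
    have h1 := hL.le_mul_dist (A j) 0
    rw [map_zero, dist_zero_right, dist_zero_right] at h1
    refine h1.trans (mul_le_of_le_one_right L.coe_nonneg ((norm_le_l1Norm _).trans (hA j)))
  have hcompact : IsCompact K := Metric.isCompact_of_isClosed_isBounded hclosed hbdd
  -- A small multiple of the identity is feasible, so the maximal determinant is nonzero.
  set ε : ℝ := (1 + ∑ j, l1Norm (φ (Pi.single j 1)))⁻¹ with hε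
  have hs0 : 0 ≤ ∑ j, l1Norm (φ (Pi.single j 1)) := Finset.sum_nonneg fun j _ => l1Norm_nonneg _
  have hεpos : 0 < ε := by positivity
  have hmem : (fun j => ε • (Pi.single j 1 : Fin k → ℝ)) ∈ K := by
    intro j
    simp only [map_smul, l1Norm_smul, abs_of_pos hεpos]
    rw [hε, inv_mul_le_one₀ (by positivity)]
    have := Finset.single_le_sum (f := fun j => l1Norm (φ (Pi.single j 1)))
      (fun i _ => l1Norm_nonneg _) (Finset.mem_univ j)
    linarith
  have hdetc : Continuous fun A : Fin k → Fin k → ℝ => |(Matrix.of A).det| := by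
    refine Continuous.abs (Continuous.matrix_det ?_)
    exact continuous_id
  obtain ⟨A, hAK, hA⟩ := hcompact.exists_isMaxOn ⟨_, hmem⟩ hdetc.continuousOn
  have hdet : 0 < |(Matrix.of A).det| := by
    refine lt_of_lt_of_le ?_ (hA hmem)
    have : (Matrix.of fun j => ε • (Pi.single j 1 : Fin k → ℝ)) = ε • (1 : Matrix _ _ ℝ) := by
      ext i j
      simp [Matrix.one_apply, Pi.single_apply, eq_comm]
    simp only [this, Matrix.det_smul, Matrix.det_one]
    positivity
  -- By Cramer's rule the coefficients of `b` are ratios of determinants. Replacing a row by `b`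
  -- stays in `K`, so maximality of `|det A|` bounds them by `1`.
  refine ⟨A, hAK, fun b hb => ⟨fun j => ((Matrix.of A).updateRow j b).det / (Matrix.of A).det,
    fun j => ?_, ?_⟩⟩
  · rw [abs_div, div_le_one hdet]
    refine hA (show Function.update A j b ∈ K from fun i => ?_)
    by_cases h : i = j
    · subst h; simpa using hb
    · simpa [h] using hAK i
  · have h := Matrix.mulVec_cramer (Matrix.of A).transpose b
    rw [Matrix.det_transpose] at h
    have hne : (Matrix.of A).det ≠ 0 := abs_pos.1 hdet
    ext i
    have hi := congrFun h i
    simp only [Matrix.mulVec, dotProduct, Matrix.cramer_transpose_apply, Matrix.transpose_apply,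
      Matrix.of_apply, Pi.smul_apply, smul_eq_mul] at hi
    simp only [Finset.sum_apply, Pi.smul_apply, smul_eq_mul]
    rw [eq_comm, ← mul_left_cancel_iff_of_pos hdet, ← mul_right_inj' hne]
    rw [mul_left_comm, mul_left_comm _ _ (b i), ← hi, Finset.mul_sum]
    congr 1
    refine Finset.sum_congr rfl fun j _ => ?_
    field_simp

/-- A subspace of dimension at most `K` is spanned, with coefficients bounded by the norm, by
`K` vectors of `ℓ¹` norm at most one. -/
theorem exists_auerbach_family {D K : ℕ} (W : Submodule ℝ (Fin D → ℝ))
    (hW : Module.finrank ℝ W ≤ K) :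
    ∃ y : Fin K → Fin D → ℝ, (∀ j, l1Norm (y j) ≤ 1) ∧
      ∀ x ∈ W, l1Norm x ≤ 1 → ∃ c : Fin K → ℝ, (∀ j, |c j| ≤ 1) ∧ x = ∑ j, c j • y j := by
  obtain ⟨l, rfl⟩ := Nat.exists_eq_add_of_le hW
  set e := (Module.finBasis ℝ W).equivFun with he
  set φ := W.subtype ∘ₗ e.symm.toLinearMap with hφ
  have hinj : Function.Injective φ := W.injective_subtype.comp e.symm.injective
  obtain ⟨A, hA, hA'⟩ := exists_auerbach_matrix φ hinj
  -- Padding by zero vectors gives the family length exactly `K`, whatever the dimension.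
  refine ⟨Fin.append (fun j => φ (A j)) 0, fun j => ?_, fun x hx hx1 => ?_⟩
  · refine Fin.addCases (fun i => ?_) (fun i => ?_) j
    · simpa using hA i
    · simp [l1Norm_zero]
  · have hφx : φ (e ⟨x, hx⟩) = x := by simp [hφ]
    obtain ⟨c, hc, hc'⟩ := hA' (e ⟨x, hx⟩) (by rwa [hφx])
    refine ⟨Fin.append c 0, fun j => ?_, ?_⟩
    · refine Fin.addCases (fun i => ?_) (fun i => ?_) j
      · simpa using hc i
      · simp
    · rw [Fin.sum_univ_add]
      simp only [Fin.append_left, Fin.append_right, Pi.zero_apply, smul_zero,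
        Finset.sum_const_zero, add_zero]
      rw [← hφx, hc', map_sum]
      simp

/-- The grid points with coordinates in `{-1, -1 + 1/N, …, 1}` with respect to the family `y`. -/
noncomputable def gridPoint {D K : ℕ} (y : Fin K → Fin D → ℝ) (N : ℕ)
    (m : Fin K → Fin (2 * N + 1)) : Fin D → ℝ :=
  ∑ j, (((m j : ℕ) : ℝ) / N - 1) • y j

theorem exists_grid_approx {N : ℕ} (hN : 0 < N) {c : ℝ} (hc : |c| ≤ 1) :
    ∃ m : Fin (2 * N + 1), |c - (((m : ℕ) : ℝ) / N - 1)| ≤ 1 / N := by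
  have hN' : (0 : ℝ) < N := by exact_mod_cast hN
  obtain ⟨h1, h2⟩ := abs_le.1 hc
  have h0 : 0 ≤ (c + 1) * N := by nlinarith
  refine ⟨⟨⌊(c + 1) * N⌋₊, ?_⟩, ?_⟩
  · rw [Nat.lt_succ_iff]
    refine Nat.floor_le_of_le ?_
    push_cast
    nlinarith
  · have h3 := Nat.floor_le h0
    have h4 := Nat.lt_floor_add_one ((c + 1) * N)
    have : c - ((⌊(c + 1) * N⌋₊ : ℝ) / N - 1) = ((c + 1) * N - ⌊(c + 1) * N⌋₊) / N := by
      field_simp; ring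
    simp only
    rw [this, abs_of_nonneg (div_nonneg (by linarith) hN'.le)]
    gcongr
    linarith

/-- A lower bound for a linear map on the grid extends to the spanned subspace. -/
theorem le_l1Norm_mulVec_of_grid {D K d N : ℕ} (hN : 0 < N) (M : Matrix (Fin d) (Fin D) ℝ)
    {W : Submodule ℝ (Fin D → ℝ)} {y : Fin K → Fin D → ℝ} (hy : ∀ j, l1Norm (y j) ≤ 1)
    (hW : ∀ x ∈ W, l1Norm x ≤ 1 → ∃ c : Fin K → ℝ, (∀ j, |c j| ≤ 1) ∧ x = ∑ j, c j • y j)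
    {B ℓ : ℝ} (hℓ : 0 ≤ ℓ) (hB : ∀ j i, |M.mulVec (y j) i| ≤ B)
    (hgrid : ∀ m : Fin K → Fin (2 * N + 1),
      ℓ * l1Norm (gridPoint y N m) ≤ l1Norm (M.mulVec (gridPoint y N m)))
    {x : Fin D → ℝ} (hx : x ∈ W) :
    (ℓ * (1 - K / N) - K * (d * B) / N) * l1Norm x ≤ l1Norm (M.mulVec x) := by
  have hN' : (0 : ℝ) < N := by exact_mod_cast hN
  have unit : ∀ x ∈ W, l1Norm x = 1 →
      ℓ * (1 - K / N) - K * (d * B) / N ≤ l1Norm (M.mulVec x) := by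
    intro x hx hx1
    obtain ⟨c, hc, hxc⟩ := hW x hx hx1.le
    choose m hm using fun j => exists_grid_approx hN (hc j)
    have hdiff : x - gridPoint y N m = ∑ j, (c j - (((m j : ℕ) : ℝ) / N - 1)) • y j := by
      rw [hxc, gridPoint, ← Finset.sum_sub_distrib]
      simp only [sub_smul]
    have h1 : l1Norm (x - gridPoint y N m) ≤ K / N := by
      rw [hdiff]
      refine (l1Norm_sum_le _ _).trans ((Finset.sum_le_card_nsmul _ _ (1 / N : ℝ)
        fun j _ => ?_).trans_eq (by simp [div_eq_mul_inv]))
      rw [l1Norm_smul]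
      exact (mul_le_mul (hm j) (hy j) (l1Norm_nonneg _) (by positivity)).trans_eq (mul_one _)
    -- The crude entrywise bound `B` suffices here, since a large `N` absorbs it.
    have h2 : l1Norm (M.mulVec (x - gridPoint y N m)) ≤ K * (d * B) / N := by
      rw [hdiff, Matrix.mulVec_sum]
      refine (l1Norm_sum_le _ _).trans ((Finset.sum_le_card_nsmul _ _ (1 / N * (d * B) : ℝ)
        fun j _ => ?_).trans_eq (by simp [div_eq_mul_inv]; ring))
      rw [Matrix.mulVec_smul, l1Norm_smul]
      refine mul_le_mul (hm j) ?_ (l1Norm_nonneg _) (by positivity)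
      exact (Finset.sum_le_card_nsmul _ _ B fun i _ => hB j i).trans_eq (by simp)
    have h3 : 1 ≤ l1Norm (gridPoint y N m) + K / N := by
      have := l1Norm_add_le (gridPoint y N m) (x - gridPoint y N m)
      rw [add_sub_cancel, hx1] at this
      linarith
    have h4 : l1Norm (M.mulVec (gridPoint y N m))
        ≤ l1Norm (M.mulVec x) + l1Norm (M.mulVec (x - gridPoint y N m)) := by
      have := l1Norm_add_le (M.mulVec x) ((-1 : ℝ) • M.mulVec (x - gridPoint y N m))
      rw [l1Norm_smul, Matrix.mulVec_sub] at this
      simp only [neg_smul, one_smul, neg_sub, add_sub_cancel, abs_neg, abs_one, one_mul] at this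
      rwa [Matrix.mulVec_sub]
    have h5 := hgrid m
    have h6 : ℓ * (1 - K / N) ≤ ℓ * l1Norm (gridPoint y N m) :=
      mul_le_mul_of_nonneg_left (by linarith) hℓ
    linarith
  rcases (l1Norm_nonneg x).eq_or_lt with h0 | hpos
  · rw [← h0, mul_zero]; exact l1Norm_nonneg _
  · have h := unit ((l1Norm x)⁻¹ • x) (W.smul_mem _ hx)
      (by rw [l1Norm_smul, abs_of_pos (by positivity), inv_mul_cancel₀ hpos.ne'])
    rw [Matrix.mulVec_smul, l1Norm_smul, abs_of_pos (by positivity)] at h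
    calc _ ≤ (l1Norm x)⁻¹ * l1Norm (M.mulVec x) * l1Norm x :=
          mul_le_mul_of_nonneg_right h hpos.le
      _ = _ := by field_simp

/-! ### Choice of the target dimension -/

/-- For large dimension the typical size of a fixed image, shrunk by `θ < 1 - α`, is below the
uniform lower bound obtained from truncation at `x ^ (1 - α)`. -/
theorem exists_forall_ge_upper_lt_lower {α θ : ℝ} (hθ : 0 < θ) (hθα : θ < 1 - α) :
    ∃ x₀ : ℝ, 1 ≤ x₀ ∧ ∀ x : ℝ, x₀ ≤ x →
      θ * (x * (Real.log (1 + (8 * x) ^ 2) / Real.pi + 1) + 2 * (8 * x))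
        < x * (Real.log (1 + (x ^ (1 - α)) ^ 2) / Real.pi - 2) - 2 := by
  have hpi := Real.pi_pos
  -- Above this value of `log x` the leading difference `2 (1 - α - θ) log x` beats all constants:
  -- `65` from `1 + 64 x² ≤ 65 x²`, `17 = 1 + 16`, and `4 = 2 + 2` with the final `-2` absorbed by
  -- `x ≥ 1`.
  set R : ℝ := (θ * (Real.log 65 + 17 * Real.pi) + 4 * Real.pi) / (2 * (1 - α - θ)) + 1 with hR
  refine ⟨max 1 (Real.exp R), le_max_left _ _, fun x hx => ?_⟩
  have hx1 : 1 ≤ x := (le_max_left _ _).trans hx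
  have hx0 : 0 < x := by linarith
  have hlog : R ≤ Real.log x := by
    rw [Real.le_log_iff_exp_le hx0]; exact (le_max_right _ _).trans hx
  have h1 : Real.log (1 + (8 * x) ^ 2) ≤ Real.log 65 + 2 * Real.log x := by
    rw [show 2 * Real.log x = Real.log (x ^ 2) by simp, ← Real.log_mul (by norm_num) (by positivity)]
    refine Real.log_le_log (by positivity) ?_
    nlinarith
  have h2 : 2 * (1 - α) * Real.log x ≤ Real.log (1 + (x ^ (1 - α)) ^ 2) := by
    rw [mul_assoc, ← Real.log_rpow hx0,
      show 2 * Real.log (x ^ (1 - α)) = Real.log ((x ^ (1 - α)) ^ 2) by simp]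
    exact Real.log_le_log (by positivity) (by linarith)
  have hpos : 0 < 2 * (1 - α - θ) := by linarith
  have h3 : θ * (Real.log 65 + 17 * Real.pi) + 4 * Real.pi < 2 * (1 - α - θ) * Real.log x := by
    rw [mul_comm (2 * (1 - α - θ)), ← div_lt_iff₀ hpos]
    linarith
  have h4 : θ * (Real.log (1 + (8 * x) ^ 2) / Real.pi + 17)
      < Real.log (1 + (x ^ (1 - α)) ^ 2) / Real.pi - 4 := by
    have e1 : θ * (Real.log (1 + (8 * x) ^ 2) / Real.pi + 17)
        = θ * (Real.log (1 + (8 * x) ^ 2) + 17 * Real.pi) / Real.pi := by field_simp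
    have e2 : Real.log (1 + (x ^ (1 - α)) ^ 2) / Real.pi - 4
        = (Real.log (1 + (x ^ (1 - α)) ^ 2) - 4 * Real.pi) / Real.pi := by field_simp
    rw [e1, e2]
    refine div_lt_div_of_pos_right ?_ hpi
    have := mul_le_mul_of_nonneg_left h1 hθ.le
    linarith
  have h5 := mul_lt_mul_of_pos_left h4 hx0
  nlinarith

/-- Resolves a circularity: the grid size involves `log d`, hence `log C`, while `d ^ α` grows like
`C ^ α`. The `C / 2` allows for rounding `d` to an integer. -/
theorem exists_forall_ge_log_le_rpow {α : ℝ} (hα : 0 < α) (a b : ℝ) :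
    ∃ C₀ : ℝ, ∀ C, C₀ ≤ C → a + b * Real.log C ≤ (C / 2) ^ α := by
  have h1 : (fun C : ℝ => a + b * Real.log C) =o[Filter.atTop] fun C => C ^ α := by
    refine Asymptotics.IsLittleO.add ?_ ((isLittleO_log_rpow_atTop hα).const_mul_left b)
    refine Asymptotics.isLittleO_const_left.2 (Or.inr ?_)
    exact tendsto_norm_atTop_atTop.comp (tendsto_rpow_atTop hα)
  have h2 := h1.bound (c := (2 ^ α)⁻¹) (by positivity)
  obtain ⟨C₀, hC₀⟩ := Filter.eventually_atTop.1 (h2.and (Filter.eventually_ge_atTop 0))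
  refine ⟨C₀, fun C hC => ?_⟩
  obtain ⟨h3, h4⟩ := hC₀ C hC
  have h5 : 0 ≤ C ^ α := Real.rpow_nonneg h4 α
  rw [Real.norm_of_nonneg h5] at h3
  rw [Real.div_rpow h4 (by norm_num), div_eq_inv_mul]
  exact (Real.le_norm_self _).trans h3

/-- The choice of the target dimension: large enough for the concentration bounds, and for the
union bound over grids in `n` subspaces of dimension `r + 1`. -/
theorem exists_dimension_constant {α θ : ℝ} (hα : 0 < α) (hθ : 0 < θ) (hθα : θ < 1 - α) :
    ∃ C : ℝ, 0 < C ∧ ∀ n r : ℕ, 2 ≤ n → 1 ≤ r → r < n →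
      ∃ d : ℕ, (d : ℝ) ≤ C * ((r : ℝ) * Real.log n) ^ (1 / α) ∧ 1 ≤ d ∧
        θ * (d * (Real.log (1 + (8 * d : ℝ) ^ 2) / Real.pi + 1) + 2 * (8 * d))
          < d * (Real.log (1 + ((d : ℝ) ^ (1 - α)) ^ 2) / Real.pi - 2) - 2 ∧
        n * ((2 * (8 * n * (r + 1) ^ 2 * d ^ 2) + 1 : ℕ) : ℝ) ^ (r + 1)
          * Real.exp (-(d / (d : ℝ) ^ (1 - α))) ≤ 1 / 8 := by
  obtain ⟨x₀, hx₀, hlt⟩ := exists_forall_ge_upper_lt_lower hθ hθα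
  -- With `X = r log n ≥ 1/2`, the constant is `25 = 18 + 1 + 6`: grid cardinality, `log n ≤ X`, and
  -- `3 ≤ 6 X`.
  obtain ⟨C₀, hC₀⟩ := exists_forall_ge_log_le_rpow hα (25 + 8 / α) 8
  have hl2 : 0 < Real.log 2 := Real.log_pos one_lt_two
  have hl2' : 1 / 2 ≤ Real.log 2 := by have := Real.log_two_gt_d9; linarith
  set s : ℝ := Real.log 2 ^ (1 / α) with hs
  have hspos : 0 < s := Real.rpow_pos_of_pos hl2 _
  set C : ℝ := max (max C₀ 1) ((x₀ + 1) / s) with hC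
  have hC1 : 1 ≤ C := (le_max_right _ _).trans (le_max_left _ _)
  have hC0 : 0 < C := by linarith
  have hCs : x₀ + 1 ≤ C * s := by
    rw [← div_le_iff₀ hspos]; exact le_max_right _ _
  have hClog := hC₀ C ((le_max_left _ _).trans (le_max_left _ _))
  have hlogC : 0 ≤ Real.log C := Real.log_nonneg hC1
  refine ⟨C, hC0, fun n r hn hr hrn => ?_⟩
  have hnR : (2 : ℝ) ≤ n := by exact_mod_cast hn
  have hrR : (1 : ℝ) ≤ r := by exact_mod_cast hr
  have hrnR : (r : ℝ) + 1 ≤ n := by exact_mod_cast hrn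
  have hLn : Real.log 2 ≤ Real.log n := Real.log_le_log two_pos hnR
  set Ln := Real.log n with hLndef
  have hLn' : 1 / 2 ≤ Ln := hl2'.trans hLn
  set X : ℝ := r * Ln with hX
  have hX2 : Real.log 2 ≤ X := hLn.trans (le_mul_of_one_le_left (by linarith) hrR)
  have hX0 : 0 < X := hl2.trans_le hX2
  set Y : ℝ := C * X ^ (1 / α) with hY
  have hYs : x₀ + 1 ≤ Y := hCs.trans (mul_le_mul_of_nonneg_left
    (Real.rpow_le_rpow hl2.le hX2 (by positivity)) hC0.le)
  have hY0 : 0 < Y := by linarith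
  set d : ℕ := ⌊Y⌋₊ with hd
  have hdY : (d : ℝ) ≤ Y := Nat.floor_le hY0.le
  have hYd : Y < d + 1 := Nat.lt_floor_add_one Y
  have hdx : x₀ ≤ d := by linarith
  have hd1 : (1 : ℝ) ≤ d := hx₀.trans hdx
  have hd0 : (0 : ℝ) < d := by linarith
  refine ⟨d, hdY, by exact_mod_cast hd1, hlt d hdx, ?_⟩
  have hdα : (25 + 8 / α + 8 * Real.log C) * X ≤ (d : ℝ) ^ α := by
    -- Since `Y ≥ x₀ + 1 ≥ 2`, the floor keeps at least half of `Y`.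
    have h1 : C / 2 * X ^ (1 / α) ≤ d := by rw [hY] at hYd hYs; linarith
    have h2 := Real.rpow_le_rpow (by positivity) h1 hα.le
    rw [Real.mul_rpow (by positivity) (by positivity), ← Real.rpow_mul hX0.le,
      one_div_mul_cancel hα.ne', Real.rpow_one] at h2
    exact (mul_le_mul_of_nonneg_right hClog hX0.le).trans h2
  have hratio : (d : ℝ) / (d : ℝ) ^ (1 - α) = (d : ℝ) ^ α := by
    rw [Real.rpow_sub hd0, Real.rpow_one]; field_simp
  have hlogd : Real.log d ≤ Real.log C + 2 / α * Ln := by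
    have h1 : Real.log d ≤ Real.log Y := Real.log_le_log hd0 hdY
    rw [hY, Real.log_mul hC0.ne' (by positivity), Real.log_rpow hX0] at h1
    have h2 : X ≤ (n : ℝ) ^ 2 := by
      have : Ln ≤ n := Real.log_le_self (by positivity)
      nlinarith
    have h3 : Real.log X ≤ 2 * Ln := by
      have := Real.log_le_log hX0 h2
      simpa using this
    have h4 := mul_le_mul_of_nonneg_left h3 (by positivity : 0 ≤ 1 / α)
    have h5 : 1 / α * (2 * Ln) = 2 / α * Ln := by ring
    linarith
  set M : ℝ := ((2 * (8 * n * (r + 1) ^ 2 * d ^ 2) + 1 : ℕ) : ℝ) with hM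
  have hM1 : M ≤ 17 * (n : ℝ) ^ 3 * (d : ℝ) ^ 2 := by
    rw [hM]; push_cast
    have h1 : ((r : ℝ) + 1) ^ 2 ≤ (n : ℝ) ^ 2 := by gcongr
    have h2 : (1 : ℝ) ≤ (n : ℝ) ^ 3 * (d : ℝ) ^ 2 :=
      one_le_mul_of_one_le_of_one_le (one_le_pow₀ (by linarith)) (one_le_pow₀ hd1)
    have h3 : (n : ℝ) * ((r : ℝ) + 1) ^ 2 * (d : ℝ) ^ 2 ≤ (n : ℝ) * (n : ℝ) ^ 2 * (d : ℝ) ^ 2 := by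
      gcongr
    nlinarith
  have hMpos : 0 < M := by rw [hM]; positivity
  have hlog17 : Real.log 17 ≤ 3 := by
    rw [Real.log_le_iff_le_exp (by norm_num)]
    have h := Real.exp_one_gt_d9
    have h1 : Real.exp 3 = Real.exp 1 ^ 3 := by rw [← Real.exp_nat_mul]; norm_num
    rw [h1]
    calc (17 : ℝ) ≤ 2.7 ^ 3 := by norm_num
      _ ≤ _ := by gcongr; linarith
  have hlogM : Real.log M ≤ Ln * (9 + 4 / α + 4 * Real.log C) := by
    have h1 := Real.log_le_log hMpos hM1
    rw [Real.log_mul (by positivity) (by positivity), Real.log_mul (by norm_num) (by positivity),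
      Real.log_pow, Real.log_pow] at h1
    push_cast at h1
    have h2 : Real.log C ≤ 2 * Ln * Real.log C :=
      le_mul_of_one_le_left hlogC (by linarith)
    have h3 : Ln * (9 + 4 / α + 4 * Real.log C)
      = 9 * Ln + 2 * (2 / α * Ln) + 2 * (2 * Ln * Real.log C) := by ring
    rw [h3]
    linarith
  have hlogM0 : 0 ≤ Real.log M := by
    refine Real.log_nonneg ?_
    rw [hM, Nat.one_le_cast]; exact Nat.le_add_left 1 _
  have hn0 : (0 : ℝ) < n := by linarith
  have hfinal : Ln + (r + 1) * Real.log M + 3 ≤ (d : ℝ) ^ α := by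
    refine le_trans ?_ hdα
    have h1 : ((r : ℝ) + 1) * Real.log M ≤ 2 * r * (Ln * (9 + 4 / α + 4 * Real.log C)) :=
      mul_le_mul (by linarith) hlogM hlogM0 (by positivity)
    have h2 : Ln ≤ X := le_mul_of_one_le_left (by linarith) hrR
    have h3 : 2 * (r : ℝ) * (Ln * (9 + 4 / α + 4 * Real.log C))
      = (18 + 8 / α + 8 * Real.log C) * X := by rw [hX]; ring
    rw [h3] at h1
    linarith
  rw [hratio]
  calc (n : ℝ) * M ^ (r + 1) * Real.exp (-(d : ℝ) ^ α)
      = Real.exp (Ln + (r + 1) * Real.log M - (d : ℝ) ^ α) := by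
        rw [Real.exp_sub, Real.exp_add, hLndef, Real.exp_log hn0, Real.exp_neg, ← Real.log_rpow hMpos,
          Real.exp_log (by positivity), div_eq_mul_inv]
        congr 2
        exact_mod_cast (Real.rpow_natCast M (r + 1)).symm
    _ ≤ Real.exp (-3) := Real.exp_le_exp.2 (by linarith)
    _ ≤ 1 / 8 := by
        rw [Real.exp_neg, one_div]
        refine inv_anti₀ (by norm_num) ?_
        have h := Real.exp_one_gt_d9
        have h1 : Real.exp 3 = Real.exp 1 ^ 3 := by rw [← Real.exp_nat_mul]; norm_num
        rw [h1]
        calc (8 : ℝ) ≤ 2 ^ 3 := by norm_num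
          _ ≤ _ := by gcongr; linarith

/-! ### Tail bounds for `P x` and the good event -/

section ScaledTails

variable {Ω : Type*} [MeasurableSpace Ω] {μ : Measure Ω} {d D : ℕ}
  {P : Ω → Matrix (Fin d) (Fin D) ℝ}

theorem l1Norm_inv_smul_self {m : ℕ} {x : Fin m → ℝ} (hx : 0 < l1Norm x) :
    l1Norm ((l1Norm x)⁻¹ • x) = 1 := by
  rw [l1Norm_smul, abs_of_pos (by positivity), inv_mul_cancel₀ hx.ne']

theorem l1Norm_mulVec_eq_mul_sum (M : Matrix (Fin d) (Fin D) ℝ) {x : Fin D → ℝ}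
    (hx : 0 < l1Norm x) :
    l1Norm (M.mulVec x) = l1Norm x * ∑ i, |M.mulVec ((l1Norm x)⁻¹ • x) i| := by
  have : l1Norm (M.mulVec ((l1Norm x)⁻¹ • x)) = (l1Norm x)⁻¹ * l1Norm (M.mulVec x) := by
    rw [Matrix.mulVec_smul, l1Norm_smul, abs_of_pos (by positivity)]
  change _ = l1Norm x * l1Norm (M.mulVec ((l1Norm x)⁻¹ • x))
  rw [this]; field_simp

/-- Homogeneity reduces to `‖x‖₁ = 1`. The strict inequality makes the bad event empty for `x = 0`.
-/
theorem IsIIDCauchy.measureReal_l1Norm_mulVec_lt_le (hP : IsIIDCauchy P μ) (x : Fin D → ℝ)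
    {T : ℝ} (hT : 0 < T) :
    μ.real {ω | l1Norm ((P ω).mulVec x) < d * (Real.log (1 + T ^ 2) / Real.pi - 2) * l1Norm x}
      ≤ Real.exp (-(d / T)) := by
  have : IsProbabilityMeasure μ := hP.indep.isProbabilityMeasure
  rcases (l1Norm_nonneg x).eq_or_lt with h0 | hpos
  · have : ∀ ω, ¬ l1Norm ((P ω).mulVec x) < 0 := fun ω => not_lt.2 (l1Norm_nonneg _)
    simp only [← h0, mul_zero, this]
    simpa using (Real.exp_pos _).le
  · refine le_trans (measureReal_mono fun ω hω => ?_) (measureReal_sum_abs_le_le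
      (hP.iIndepFun_mulVec _) (hP.hasLaw_mulVec (l1Norm_inv_smul_self hpos)) hT)
    simp only [Set.mem_ofPred_eq] at hω ⊢
    rw [l1Norm_mulVec_eq_mul_sum _ hpos, mul_comm] at hω
    exact (lt_of_mul_lt_mul_right hω hpos.le).le

theorem IsIIDCauchy.measureReal_lt_l1Norm_mulVec_le (hP : IsIIDCauchy P μ) (x : Fin D → ℝ)
    {T : ℝ} (hT : 0 < T) :
    μ.real {ω | (d * (Real.log (1 + T ^ 2) / Real.pi + 1) + 2 * T) * l1Norm x
        < l1Norm ((P ω).mulVec x)} ≤ d / T + Real.exp (-2) := by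
  have : IsProbabilityMeasure μ := hP.indep.isProbabilityMeasure
  rcases (l1Norm_nonneg x).eq_or_lt with h0 | hpos
  · rw [l1Norm_eq_zero h0.symm]
    simp only [Matrix.mulVec_zero, l1Norm_zero, mul_zero, lt_irrefl]
    simpa using (by positivity : 0 ≤ d / T + Real.exp (-2))
  · refine le_trans (measureReal_mono fun ω hω => ?_) (measureReal_le_sum_abs_le
      (hP.iIndepFun_mulVec _) (hP.hasLaw_mulVec (l1Norm_inv_smul_self hpos)) hT)
    simp only [Set.mem_ofPred_eq] at hω ⊢
    rw [l1Norm_mulVec_eq_mul_sum _ hpos, mul_comm (l1Norm x)] at hω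
    exact (lt_of_mul_lt_mul_right hω hpos.le).le

theorem IsIIDCauchy.measureReal_lt_abs_mulVec_le (hP : IsIIDCauchy P μ) {x : Fin D → ℝ}
    (hx : l1Norm x ≤ 1) {B : ℝ} (hB : 0 < B) (i : Fin d) :
    μ.real {ω | B < |(P ω).mulVec x i|} ≤ 1 / B := by
  have : IsProbabilityMeasure μ := hP.indep.isProbabilityMeasure
  rcases (l1Norm_nonneg x).eq_or_lt with h0 | hpos
  · rw [l1Norm_eq_zero h0.symm]
    simp only [Matrix.mulVec_zero, Pi.zero_apply, abs_zero, not_lt.2 hB.le]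
    simpa using hB.le
  · have hms : MeasurableSet {x : ℝ | B < |x|} :=
      measurableSet_lt measurable_const measurable_id.abs
    have h := (hP.hasLaw_mulVec (l1Norm_inv_smul_self hpos) i).measureReal_eq
      (p := fun x => B < |x|) hms
    refine le_trans (measureReal_mono fun ω hω => ?_)
      (h.trans_le (cauchyMeasure_real_abs_gt_le hB))
    simp only [Set.mem_ofPred_eq] at hω ⊢
    refine hω.trans_le ?_
    rw [Matrix.mulVec_smul, Pi.smul_apply, smul_eq_mul, abs_mul,
      abs_of_pos (inv_pos.2 hpos)]
    exact le_mul_of_one_le_left (abs_nonneg _) ((one_le_inv₀ hpos).2 hx)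

/-- The complement of three bad events: a fixed image is not too large, the images of the
spanning families are not huge, and the images of all grid points are not too small. -/
theorem IsIIDCauchy.measureReal_good_event_ge (hP : IsIIDCauchy P μ) {n k N : ℕ}
    (hd : 0 < d) (hn : 0 < n) (hk : 0 < k)
    (x : Fin D → ℝ) (y : Fin n → Fin k → Fin D → ℝ) (hy : ∀ a j, l1Norm (y a j) ≤ 1)
    {T : ℝ} (hT : 0 < T)
    (hN : n * ((2 * N + 1 : ℕ) : ℝ) ^ k * Real.exp (-(d / T)) ≤ 1 / 8) :
    1 / 4 ≤ μ.real {ω |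
      l1Norm ((P ω).mulVec x) ≤
        (d * (Real.log (1 + (8 * d : ℝ) ^ 2) / Real.pi + 1) + 2 * (8 * d)) * l1Norm x ∧
      (∀ a j i, |(P ω).mulVec (y a j) i| ≤ 8 * n * k * d) ∧
      ∀ a m, d * (Real.log (1 + T ^ 2) / Real.pi - 2) * l1Norm (gridPoint (y a) N m)
        ≤ l1Norm ((P ω).mulVec (gridPoint (y a) N m))} := by
  have : IsProbabilityMeasure μ := hP.indep.isProbabilityMeasure
  have hdR : (0 : ℝ) < d := by exact_mod_cast hd
  have hnR : (0 : ℝ) < n := by exact_mod_cast hn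
  have hkR : (0 : ℝ) < k := by exact_mod_cast hk
  set G : Set Ω := _
  change 1 / 4 ≤ μ.real G
  set U := {ω | (d * (Real.log (1 + (8 * d : ℝ) ^ 2) / Real.pi + 1) + 2 * (8 * d)) * l1Norm x
    < l1Norm ((P ω).mulVec x)} with hU
  set V := ⋃ e : Fin n × Fin k × Fin d,
    {ω | (8 * n * k * d : ℝ) < |(P ω).mulVec (y e.1 e.2.1) e.2.2|} with hV
  set W := ⋃ e : Fin n × (Fin k → Fin (2 * N + 1)),
    {ω | l1Norm ((P ω).mulVec (gridPoint (y e.1) N e.2))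
      < d * (Real.log (1 + T ^ 2) / Real.pi - 2) * l1Norm (gridPoint (y e.1) N e.2)} with hW
  -- Truncation at `8 * d` gives `d / (8 d) = 1/8`, and `exp (-2) ≤ 1/4`.
  have hU' : μ.real U ≤ 1 / 8 + 1 / 4 := by
    refine (hP.measureReal_lt_l1Norm_mulVec_le x (by positivity)).trans (add_le_add ?_ ?_)
    · exact le_of_eq (by field_simp)
    · rw [Real.exp_neg, one_div]
      refine inv_anti₀ (by norm_num) ?_
      have h := Real.exp_one_gt_d9
      have h1 : Real.exp 2 = Real.exp 1 ^ 2 := by rw [← Real.exp_nat_mul]; norm_num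
      rw [h1]
      nlinarith
  have hV' : μ.real V ≤ 1 / 8 := by
    refine (measureReal_iUnion_fintype_le _).trans ((Finset.sum_le_card_nsmul _ _
      (1 / (8 * n * k * d : ℝ)) fun e _ =>
        hP.measureReal_lt_abs_mulVec_le (hy _ _) (by positivity) _).trans_eq ?_)
    simp
    field_simp
  have hW' : μ.real W ≤ 1 / 8 := by
    refine (measureReal_iUnion_fintype_le _).trans ((Finset.sum_le_card_nsmul _ _
      (Real.exp (-(d / T))) fun e _ =>
        hP.measureReal_l1Norm_mulVec_lt_le _ hT).trans (le_of_eq_of_le ?_ hN))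
    simp
  -- Covering the space uses subadditivity only, so `G` need not be measurable. The bad events have
  -- total mass at most `5/8`.
  have hcover : (Set.univ : Set Ω) ⊆ G ∪ (U ∪ (V ∪ W)) := by
    intro ω _
    by_cases h : ω ∈ U ∪ (V ∪ W)
    · exact Or.inr h
    · left
      simp only [hU, hV, hW, Set.mem_union, Set.mem_iUnion, Set.mem_ofPred_eq, not_or, not_exists,
        not_lt, Prod.forall] at h
      exact h
  have h := (measureReal_mono hcover (μ := μ)).trans ((measureReal_union_le _ _).trans
    (add_le_add_right ((measureReal_union_le _ _).trans
      (add_le_add_right (measureReal_union_le _ _) _)) _))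
  rw [probReal_univ] at h
  linarith

end ScaledTails

/-! ### Distances, minimizers and the loss from the grid -/

section Distances

theorem bddBelow_l1Norm_sub {m : ℕ} (q : Fin m → ℝ) (S : Submodule ℝ (Fin m → ℝ)) :
    BddBelow (Set.range fun v : S => l1Norm (q - (v : Fin m → ℝ))) :=
  ⟨0, by rintro _ ⟨v, rfl⟩; exact l1Norm_nonneg _⟩

theorem l1Dist_le {m : ℕ} (q : Fin m → ℝ) {S : Submodule ℝ (Fin m → ℝ)} {v : Fin m → ℝ}
    (hv : v ∈ S) : l1Dist q S ≤ l1Norm (q - v) :=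
  ciInf_le (bddBelow_l1Norm_sub q S) ⟨v, hv⟩

theorem exists_l1Norm_sub_lt {m : ℕ} {q : Fin m → ℝ} {S : Submodule ℝ (Fin m → ℝ)} {a : ℝ}
    (h : l1Dist q S < a) : ∃ v ∈ S, l1Norm (q - v) < a := by
  obtain ⟨v, hv⟩ := exists_lt_of_ciInf_lt h
  exact ⟨v, v.2, hv⟩

theorem argminSet_eq_singleton {ι : Type*} {f : ι → ℝ} {a : ι} (h : ∀ j, j ≠ a → f a < f j) :
    argminSet f = {a} := by
  ext i
  simp only [argminSet, Set.mem_ofPred_eq, Set.mem_singleton_iff]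
  refine ⟨fun hi => ?_, ?_⟩
  · by_contra hne
    exact absurd (hi a) (not_le.2 (h i hne))
  · rintro rfl j
    by_cases hj : j = i
    · rw [hj]
    · exact (h j hj).le

theorem ascending_one_le {n : ℕ} (hn : 1 < n) (hn0 : 0 < n) (f : Fin n → ℝ) {j : Fin n}
    (hj : j ≠ Tuple.sort f ⟨0, hn0⟩) : ascending f ⟨1, hn⟩ ≤ f j := by
  obtain ⟨k, rfl⟩ := (Tuple.sort f).surjective j
  have hk : k ≠ ⟨0, hn0⟩ := fun h => hj (by rw [h])
  exact Tuple.monotone_sort f (Fin.le_def.2 (Nat.one_le_iff_ne_zero.2 fun h => hk (Fin.ext h)))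

end Distances

/-- On a fine enough grid, the loss in passing from the grid to the subspace is at most `2`. -/
theorem sub_two_le_grid_bound {d n r N : ℕ} (hd : 1 ≤ d) (hn : 2 ≤ n) {T ℓ : ℝ} (hT : 0 < T)
    (hTd : T ≤ d) (hN : N = 8 * n * (r + 1) ^ 2 * d ^ 2)
    (hℓ : ℓ = d * (Real.log (1 + T ^ 2) / Real.pi - 2)) :
    ℓ - 2 ≤ ℓ * (1 - ((r + 1 : ℕ) : ℝ) / N)
      - ((r + 1 : ℕ) : ℝ) * (d * (8 * n * ((r + 1 : ℕ) : ℝ) * d)) / N := by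
  have hdR : (1 : ℝ) ≤ d := by exact_mod_cast hd
  have hd0 : (0 : ℝ) < d := by linarith
  have hnR : (2 : ℝ) ≤ n := by exact_mod_cast hn
  have hn0 : (0 : ℝ) < n := by linarith
  have hNR : (N : ℝ) = 8 * n * ((r : ℝ) + 1) ^ 2 * (d : ℝ) ^ 2 := by rw [hN]; push_cast; ring
  have hr1 : (1 : ℝ) ≤ (r : ℝ) + 1 := by linarith [(Nat.cast_nonneg r : (0 : ℝ) ≤ r)]
  have hr0 : (0 : ℝ) < (r : ℝ) + 1 := by linarith
  -- `N` is chosen to make this term exactly `1`.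
  have e1 : ((r + 1 : ℕ) : ℝ) * (d * (8 * n * ((r + 1 : ℕ) : ℝ) * d)) / N = 1 := by
    rw [hNR]; push_cast; field_simp
  have hlog : Real.log (1 + T ^ 2) ≤ 2 * d := by
    calc Real.log (1 + T ^ 2) ≤ Real.log ((1 + d) ^ 2) :=
          Real.log_le_log (by positivity) (by nlinarith)
      _ = 2 * Real.log (1 + d) := by simp
      _ ≤ 2 * d := by
          have := Real.log_le_sub_one_of_pos (show (0 : ℝ) < 1 + d by linarith)
          linarith
  have hℓd : ℓ ≤ 2 * d ^ 2 := by
    have hpi := Real.pi_gt_three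
    have : Real.log (1 + T ^ 2) / Real.pi ≤ 2 * d :=
      (div_le_self (Real.log_nonneg (by nlinarith)) (by linarith)).trans hlog
    rw [hℓ]
    have := mul_le_mul_of_nonneg_left this hd0.le
    nlinarith
  have hkN : ((r + 1 : ℕ) : ℝ) / N ≤ 1 / (2 * d ^ 2) := by
    rw [hNR, div_le_div_iff₀ (by positivity) (by positivity)]
    push_cast
    have h3 : (1 : ℝ) ≤ n * ((r : ℝ) + 1) := by nlinarith
    have h4 : 0 ≤ ((r : ℝ) + 1) * (d : ℝ) ^ 2 := by positivity
    have h5 := mul_le_mul_of_nonneg_left h3 h4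
    linarith
  have e2 : ℓ * (((r + 1 : ℕ) : ℝ) / N) ≤ 1 := by
    calc ℓ * (((r + 1 : ℕ) : ℝ) / N) ≤ 2 * d ^ 2 * (1 / (2 * d ^ 2)) :=
          mul_le_mul hℓd hkN (by positivity) (by positivity)
      _ = 1 := by field_simp
  rw [e1, mul_sub]
  linarith

/-! ### The main theorem -/

theorem theorem1 :
    ∃ p : ℝ, 0 < p ∧
      ∀ η : ℝ, 1 < η → ∀ α : ℝ, 0 < α → α < 1 - 1 / η →
        ∃ C : ℝ, 0 < C ∧
          ∀ (n r : ℕ) (hn : 2 ≤ n), r < n →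
            ∃ d : ℕ, (d : ℝ) ≤ C * ((r : ℝ) * Real.log n) ^ (1 / α) ∧
              ∀ (D : ℕ) (S : Fin n → Submodule ℝ (Fin D → ℝ)) (q : Fin D → ℝ),
                (∀ i, Module.finrank ℝ (S i) = r) →
                0 < ascending (fun i => l1Dist q (S i)) ⟨1, hn⟩ →
                η * ascending (fun i => l1Dist q (S i)) ⟨0, by omega⟩
                  ≤ ascending (fun i => l1Dist q (S i)) ⟨1, hn⟩ →
                ∀ (Ω : Type*) [MeasurableSpace Ω] (μ : Measure Ω) [IsProbabilityMeasure μ]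
                  (P : Ω → Matrix (Fin d) (Fin D) ℝ), IsIIDCauchy P μ →
                  p ≤ μ.real {ω | argminSet (fun i =>
                        l1Dist ((P ω).mulVec q) ((S i).map (P ω).mulVecLin))
                      = argminSet (fun i => l1Dist q (S i))} := by
  refine ⟨1 / 4, by norm_num, fun η hη α hα hαη => ?_⟩
  have hη0 : 0 < η := by linarith
  have hη1 : 0 < 1 / η := by positivity
  -- The room on both sides of `θ` serves twice: `1/η < θ` allows an approximate minimizer, `θ < 1 -
  -- α` absorbs lower order terms for large `d`.
  obtain ⟨θ, hθ1, hθ2⟩ := exists_between (show 1 / η < 1 - α by linarith)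
  have hθ0 : 0 < θ := hη1.trans hθ1
  obtain ⟨C, hC, hdim⟩ := exists_dimension_constant hα hθ0 hθ2
  refine ⟨C, hC, fun n r hn hrn => ?_⟩
  rcases Nat.eq_zero_or_pos r with rfl | hr
  · -- all subspaces are trivial, so the two smallest distances cannot differ
    refine ⟨0, by rw [Nat.cast_zero]; positivity, fun D S q hS h1 h2 => ?_⟩
    exfalso
    have hbot : ∀ i, S i = ⊥ := fun i => Submodule.finrank_eq_zero.1 (hS i)
    simp only [ascending, Function.comp_def, hbot] at h1 h2
    nlinarith
  obtain ⟨d, hdC, hd1, hul, hN⟩ := hdim n r hn hr hrn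
  refine ⟨d, hdC, fun D S q hS h1 h2 Ω _ μ _ P hP => ?_⟩
  set f : Fin n → ℝ := fun i => l1Dist q (S i) with hf
  set a : Fin n := Tuple.sort f ⟨0, by omega⟩ with ha
  set ξ : ℝ := ascending f ⟨1, hn⟩ with hξ
  have hfa : ascending f ⟨0, by omega⟩ = f a := rfl
  rw [hfa] at h2
  have hother : ∀ j, j ≠ a → ξ ≤ f j := fun j hj => ascending_one_le hn _ f hj
  have haξ : f a < θ * ξ := by
    have : f a ≤ 1 / η * ξ := by
      rw [one_div, ← div_eq_inv_mul, le_div_iff₀ hη0, mul_comm]; exact h2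
    exact this.trans_lt (mul_lt_mul_of_pos_right hθ1 h1)
  have hθ1' : θ < 1 := by linarith
  have horig : argminSet f = {a} := argminSet_eq_singleton fun j hj =>
    (haξ.trans (by nlinarith)).trans_le (hother j hj)
  obtain ⟨v, hvS, hv⟩ := exists_l1Norm_sub_lt haξ
  -- Adjoining `q` places every difference `q - w`, `w ∈ S i`, in one subspace of dimension at most
  -- `r + 1`.
  set W : Fin n → Submodule ℝ (Fin D → ℝ) := fun i => S i ⊔ Submodule.span ℝ {q} with hWdef
  have hW : ∀ i, Module.finrank ℝ (W i) ≤ r + 1 := fun i => by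
    refine (Submodule.finrank_add_le_finrank_add_finrank _ _).trans ?_
    rw [hS i]
    exact Nat.add_le_add_left ((finrank_span_le_card _).trans (by simp)) r
  choose y hy hyW using fun i => exists_auerbach_family (W i) (hW i)
  set N : ℕ := 8 * n * (r + 1) ^ 2 * d ^ 2 with hNdef
  have hdR : (1 : ℝ) ≤ d := by exact_mod_cast hd1
  have hd0 : (0 : ℝ) < d := by linarith
  have hnR : (2 : ℝ) ≤ n := by exact_mod_cast hn
  have hNpos : 0 < N := by have : 0 < n := by omega
                           positivity
  set T : ℝ := (d : ℝ) ^ (1 - α) with hT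
  have hTpos : 0 < T := Real.rpow_pos_of_pos hd0 _
  have hgood := hP.measureReal_good_event_ge (k := r + 1) (N := N) (by omega) (by omega)
    (by omega) (q - v) y hy hTpos hN
  refine hgood.trans (measureReal_mono fun ω hω => ?_)
  obtain ⟨hω1, hω2, hω3⟩ := hω
  simp only [Set.mem_ofPred_eq]
  rw [horig]
  set u : ℝ := d * (Real.log (1 + (8 * d : ℝ) ^ 2) / Real.pi + 1) + 2 * (8 * d) with hu
  set ℓ : ℝ := d * (Real.log (1 + T ^ 2) / Real.pi - 2) with hℓ
  have hu0 : 0 ≤ u := by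
    have : 0 ≤ Real.log (1 + (8 * d : ℝ) ^ 2) := Real.log_nonneg (by nlinarith)
    have := Real.pi_pos
    positivity
  have hℓ0 : 0 ≤ ℓ := by nlinarith
  set m : ℝ := ℓ * (1 - ((r + 1 : ℕ) : ℝ) / N)
    - ((r + 1 : ℕ) : ℝ) * (d * (8 * n * ((r + 1 : ℕ) : ℝ) * d)) / N with hm
  have hlow : ∀ j, ∀ x ∈ W j, m * l1Norm x ≤ l1Norm ((P ω).mulVec x) := fun j x hx =>
    le_l1Norm_mulVec_of_grid hNpos (P ω) (hy j) (hyW j) hℓ0 (hω2 j) (hω3 j) hx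
  have hℓm : ℓ - 2 ≤ m := by
    refine sub_two_le_grid_bound hd1 hn hTpos ?_ rfl rfl
    rw [hT]; nth_rewrite 2 [← Real.rpow_one (d : ℝ)]
    exact Real.rpow_le_rpow_of_exponent_le hdR (by linarith)
  -- From here on the argument is deterministic: the upper factor `u`, shrunk by `θ`, stays below
  -- the uniform lower factor `m`.
  have hum : u * θ < m := by linarith
  have hm0 : 0 < m := lt_of_le_of_lt (by positivity) hum
  refine argminSet_eq_singleton fun j hj => ?_
  have hup : l1Dist ((P ω).mulVec q) ((S a).map (P ω).mulVecLin) ≤ u * (θ * ξ) := by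
    refine (l1Dist_le _ (Submodule.mem_map_of_mem hvS)).trans ?_
    rw [Matrix.mulVecLin_apply, ← Matrix.mulVec_sub]
    exact hω1.trans (mul_le_mul_of_nonneg_left hv.le hu0)
  have hdown : m * ξ ≤ l1Dist ((P ω).mulVec q) ((S j).map (P ω).mulVecLin) := by
    refine le_ciInf ?_
    rintro ⟨_, w, hw, rfl⟩
    simp only [Matrix.mulVecLin_apply]
    rw [← Matrix.mulVec_sub]
    refine le_trans ?_ (hlow j (q - w) ?_)
    · exact mul_le_mul_of_nonneg_left ((hother j hj).trans (l1Dist_le q hw)) hm0.le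
    · exact Submodule.sub_mem _
        (Submodule.mem_sup_right (Submodule.mem_span_singleton_self q))
        (Submodule.mem_sup_left hw)
  calc _ ≤ u * (θ * ξ) := hup
    _ = u * θ * ξ := by ring
    _ < m * ξ := mul_lt_mul_of_pos_right hum h1
    _ ≤ _ := hdown
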